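/- Let $(\Omega,\mu)$ be a $\sigma$-finite measure space and $\mathcal H$ a separable complex Hilbert space, with inner product linear in the first variable. Let $D\subseteq L^\infty(\Omega)$ be a determining set for $L^1(\Omega)$, i.e. the only $f\in L^1(\Omega)$ with $\int_\Omega f g\,d\mu=0$ for all $g\in D$ is $f=0$. For $\Phi_1,\dots,\Phi_n\in L^2(\Omega,\mathcal H)$ let $M_D(\Phi_1,\dots,\Phi_n)$ be the closed linear span in $L^2(\Omega,\mathcal H)$ of $\{g\Phi_i: g\in D,\ 1\le i\le n\}$ (the zero space if $n=0$). For $M$ of this form let the length $\ell(M)$ be the least integer $n\ge 0$ such that $M=M_D(\Phi_1,\dots,\Phi_n)$ for some $\Phi_1,\dots,\Phi_n\in M$. A range function $J$ assigns to each $\omega\in\Omega$ a closed subspace $J(\omega)\subseteq\mathcal H$; it is measurable if $\omega\mapsto\langle P_J(\omega)a,b\rangle$ is $\mu$-measurable for all $a,b\in\mathcal H$, where $P_J(\omega)$ is the orthogonal projection onto $J(\omega)$. It is associated to $M$ if $M=\{F\in L^2(\Omega,\mathcal H): F(\omega)\in J(\omega)\text{ for a.e. }\omega\}$. A family $\Phi_1,\dots,\Phi_n\in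 L^2(\Omega,\mathcal H)$ is a uniform frame for $J$ if there are constants $0<\alpha\le\beta$ such that for a.e. $\omega\in\Omega$ one has $\Phi_1(\omega),\dots,\Phi_n(\omega)\in J(\omega)$ and $$\alpha\|f\|^2\le\sum_{i=1}^n|\langle f,\Phi_i(\omega)\rangle|^2\le\beta\|f\|^2\qquad\text{for all } f\in J(\omega).$$ **Theorem.** Let $\Phi_1,\dots,\Phi_m\in L^2(\Omega,\mathcal H)$, let $J$ be the measurable range function associated to $M=M_D(\Phi_1,\dots,\Phi_m)$, and suppose that $\Phi_1,\dots,\Phi_m$ is a uniform frame for $J$. Let $\ell=\ell(M)$ (so $\ell\le m$), let $A=(a_{ij})\in\mathbb C^{\ell\times m}$, and put $\Psi_i=\sum_{j=1}^m a_{ij}\Phi_j$ for $1\le i\le\ell$. Then $\Psi_1,\dots,\Psi_\ell$ is a uniform frame for $J$ if and only if $AA^*$ is invertible and $$\operatorname*{ess\,sup}_{\omega\in\Omega}\bigl\|(I_m-A^*(AA^*)^{-1}A)\,G_{\Phi(\omega)}G_{\Phi(\omega)}^\dagger\bigr\|<1 .$$ Here $G_{\Phi(\omega)}\in\mathbb C^{m\times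 m}$ is the Gramian with entries $(G_{\Phi(\omega)})_{ij}=\langle\Phi_i(\omega),\Phi_j(\omega)\rangle$, $G^\dagger$ is the Moore-Penrose pseudoinverse of $G$, $I_m$ is the identity matrix, and $\|\cdot\|$ is the operator norm on $\mathbb C^{m\times m}$ induced by the Euclidean norm (an empty matrix is invertible and has norm $0$). -/

import Mathlib

open MeasureTheory Matrix
open scoped ENNReal

/-! ### Moore-Penrose pseudoinverse -/

/-- The four Penrose equations: `X` is the Moore-Penrose pseudoinverse of `A`. -/
structure IsMoorePenrose {m n : ℕ} (A : Matrix (Fin m) (Fin n) ℂ)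
    (X : Matrix (Fin n) (Fin m) ℂ) : Prop where
  mul_mul_left : A * X * A = A
  mul_mul_right : X * A * X = X
  isHermitian_left : (A * X)ᴴ = A * X
  isHermitian_right : (X * A)ᴴ = X * A

theorem IsMoorePenrose.unique {m n : ℕ} {A : Matrix (Fin m) (Fin n) ℂ}
    {X Y : Matrix (Fin n) (Fin m) ℂ} (hX : IsMoorePenrose A X) (hY : IsMoorePenrose A Y) :
    X = Y := by
  have h1 : A * X = A * Y := by
    calc A * X = (A * Y * A) * X := by rw [hY.mul_mul_left]
      _ = (A * Y)ᴴ * (A * X)ᴴ := by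
        rw [hY.isHermitian_left, hX.isHermitian_left, Matrix.mul_assoc]
      _ = ((A * X * A) * Y)ᴴ := by
        rw [← Matrix.conjTranspose_mul]; simp only [Matrix.mul_assoc]
      _ = A * Y := by rw [hX.mul_mul_left, hY.isHermitian_left]
  have h2 : X * A = Y * A := by
    calc X * A = X * (A * Y * A) := by rw [hY.mul_mul_left]
      _ = (X * A)ᴴ * (Y * A)ᴴ := by
        rw [hY.isHermitian_right, hX.isHermitian_right]; simp only [Matrix.mul_assoc]
      _ = (Y * (A * X * A))ᴴ := by
        rw [← Matrix.conjTranspose_mul]; simp only [Matrix.mul_assoc]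
      _ = Y * A := by rw [hX.mul_mul_left, hY.isHermitian_right]
  calc X = X * A * X := hX.mul_mul_right.symm
    _ = Y * (A * X) := by rw [h2, Matrix.mul_assoc]
    _ = Y * A * Y := by rw [h1, Matrix.mul_assoc]
    _ = Y := hY.mul_mul_right

open scoped ComplexOrder in
theorem exists_isMoorePenrose {m n : ℕ} (A : Matrix (Fin m) (Fin n) ℂ) :
    ∃ X, IsMoorePenrose A X := by
  have hA : (Aᴴ * A).IsHermitian := Matrix.isHermitian_conjTranspose_mul_self A
  obtain ⟨Z, hZ1, hZ2, hZ3, hZ4⟩ : ∃ Z : Matrix (Fin n) (Fin n) ℂ,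
      (Aᴴ * A) * Z * (Aᴴ * A) = Aᴴ * A ∧ Z * (Aᴴ * A) * Z = Z ∧ Zᴴ = Z ∧
        (Aᴴ * A) * Z = Z * (Aᴴ * A) := by
    set φ := Unitary.conjStarAlgAut ℂ _ hA.eigenvectorUnitary with hφ
    have hs := hA.spectral_theorem
    rw [← hφ] at hs
    set d : Fin n → ℂ := RCLike.ofReal ∘ hA.eigenvalues with hd
    refine ⟨φ (diagonal fun i => (d i)⁻¹), ?_, ?_, ?_, ?_⟩
    · rw [hs, ← map_mul, ← map_mul, diagonal_mul_diagonal, diagonal_mul_diagonal]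
      congr 2; funext i; exact mul_inv_mul_cancel _
    · rw [hs, ← map_mul, ← map_mul, diagonal_mul_diagonal, diagonal_mul_diagonal]
      congr 2; funext i
      simpa using mul_inv_mul_cancel ((d i)⁻¹)
    · rw [← star_eq_conjTranspose, ← map_star, star_eq_conjTranspose, diagonal_conjTranspose]
      congr 2; funext i
      simp [hd]
    · rw [hs, ← map_mul, ← map_mul, diagonal_mul_diagonal, diagonal_mul_diagonal]
      congr 2; funext i; exact mul_comm _ _
  have key : A * (Z * (Aᴴ * A) - 1) = 0 := by
    rw [← Matrix.conjTranspose_mul_self_eq_zero, Matrix.conjTranspose_mul]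
    have : Aᴴ * (A * (Z * (Aᴴ * A) - 1)) = 0 := by
      rw [← Matrix.mul_assoc, Matrix.mul_sub, Matrix.mul_one, ← Matrix.mul_assoc, hZ1, sub_self]
    rw [Matrix.mul_assoc, this, Matrix.mul_zero]
  have hA1 : A * (Z * (Aᴴ * A)) = A := by
    rwa [Matrix.mul_sub, Matrix.mul_one, sub_eq_zero] at key
  refine ⟨Z * Aᴴ, ?_, ?_, ?_, ?_⟩
  · simpa only [Matrix.mul_assoc] using hA1
  · calc Z * Aᴴ * A * (Z * Aᴴ) = (Z * (Aᴴ * A) * Z) * Aᴴ := by simp only [Matrix.mul_assoc]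
      _ = Z * Aᴴ := by rw [hZ2]
  · simp only [Matrix.conjTranspose_mul, Matrix.conjTranspose_conjTranspose, hZ3,
      Matrix.mul_assoc]
  · rw [Matrix.mul_assoc, Matrix.conjTranspose_mul, hA.eq, hZ3, hZ4]

/-- The Moore-Penrose pseudoinverse `A†`. -/
noncomputable def moorePenrose {m n : ℕ} (A : Matrix (Fin m) (Fin n) ℂ) :
    Matrix (Fin n) (Fin m) ℂ :=
  (exists_isMoorePenrose A).choose

theorem moorePenrose_spec {m n : ℕ} (A : Matrix (Fin m) (Fin n) ℂ) :
    IsMoorePenrose A (moorePenrose A) :=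
  (exists_isMoorePenrose A).choose_spec

/-! ### Gramian -/

/-- The Gramian with entries `G i j = ⟨x i, x j⟩`, where `⟨·,·⟩` is linear in the first variable.
Mathlib's `inner ℂ` is linear in the second variable, hence the order of the arguments. -/
noncomputable def gramian {H : Type*} [NormedAddCommGroup H] [InnerProductSpace ℂ H] {n : ℕ}
    (x : Fin n → H) : Matrix (Fin n) (Fin n) ℂ :=
  Matrix.of fun i j => inner ℂ (x j) (x i)

/-- The operator norm of a square matrix acting on `ℂⁿ` with the Euclidean norm. -/
noncomputable def matrixOpNorm {n : ℕ} (B : Matrix (Fin n) (Fin n) ℂ) : ℝ≥0∞ :=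
  ‖Matrix.toEuclideanCLM (n := Fin n) (𝕜 := ℂ) B‖ₑ

/-! ### Multiplicatively invariant spaces -/

section MI

variable {Ω : Type*} [MeasurableSpace Ω] {μ : Measure Ω}
  {H : Type*} [NormedAddCommGroup H] [InnerProductSpace ℂ H]

/-- `D ⊆ L^∞(Ω)` is a determining set for `L¹(Ω)`. -/
def IsDeterminingSet (D : Set (Lp ℂ ∞ μ)) : Prop :=
  ∀ f : Lp ℂ 1 μ, (∀ g ∈ D, ∫ ω, f ω * g ω ∂μ = 0) → f = 0

/-- `M_D(Φ)`, the closed linear span of the pointwise products `g Φ_i`, `g ∈ D`. -/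
noncomputable def miSpan (D : Set (Lp ℂ ∞ μ)) {n : ℕ} (Φ : Fin n → Lp H 2 μ) :
    Submodule ℂ (Lp H 2 μ) :=
  (Submodule.span ℂ {F : Lp H 2 μ | ∃ g ∈ D, ∃ i, F = g • Φ i}).topologicalClosure

/-- The length of a finitely generated space `M`: the least number of generators. The zero space
has length `0` (it is generated by the empty family). -/
noncomputable def miLength (D : Set (Lp ℂ ∞ μ)) (M : Submodule ℂ (Lp H 2 μ)) : ℕ :=
  sInf {n : ℕ | ∃ Φ : Fin n → Lp H 2 μ, (∀ i, Φ i ∈ M) ∧ M = miSpan D Φ}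

/-- A range function `J` is measurable when all `ω ↦ ⟨P_J(ω) a, b⟩` are measurable, where
`P_J(ω)` is the orthogonal projection onto `J ω`. Range functions are identified when they are
equal almost everywhere, so measurability is up to a null set. -/
def IsMeasurableRangeFunction [CompleteSpace H] (μ : Measure Ω)
    (J : Ω → ClosedSubmodule ℂ H) : Prop :=
  ∀ a b : H, AEMeasurable (fun ω => inner ℂ b ((J ω).toSubmodule.starProjection a)) μ

/-- `J` is the measurable range function associated to the space `M`:
`M = {F ∈ L²(Ω, H) : F(ω) ∈ J(ω) for a.e. ω}`. -/
structure IsRangeFunctionOf [CompleteSpace H] (J : Ω → ClosedSubmodule ℂ H)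
    (M : Submodule ℂ (Lp H 2 μ)) : Prop where
  measurable : IsMeasurableRangeFunction μ J
  mem_iff : ∀ F : Lp H 2 μ, F ∈ M ↔ ∀ᵐ ω ∂μ, F ω ∈ J ω

/-- The finite family `x` is a frame for the closed subspace `K`, with frame bounds `α, β`. -/
def IsFrameFor {n : ℕ} (x : Fin n → H) (K : ClosedSubmodule ℂ H) (α β : ℝ) : Prop :=
  (∀ i, x i ∈ K) ∧ ∀ f ∈ K, α * ‖f‖ ^ 2 ≤ ∑ i, ‖inner ℂ (x i) f‖ ^ 2 ∧
    ∑ i, ‖inner ℂ (x i) f‖ ^ 2 ≤ β * ‖f‖ ^ 2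

/-- `Φ` is a uniform frame for `J`: almost all the families `Φ(ω)` are frames for `J(ω)`, with
common frame bounds. -/
def IsUniformFrame {n : ℕ} (Φ : Fin n → Lp H 2 μ) (J : Ω → ClosedSubmodule ℂ H) : Prop :=
  ∃ α β : ℝ, 0 < α ∧ α ≤ β ∧ ∀ᵐ ω ∂μ, IsFrameFor (fun i => Φ i ω) (J ω) α β

end MI

/-! ### Square sums of complex vectors and matrices -/

/-! Fix `ω`, let `x = Φ(ω)`, and for `f ∈ J ω` let `v` be the vector of coefficients `⟨x i, f⟩`.
Passing from `Φ` to `Ψ` replaces `v` by `A v`. If `A * Aᴴ` is invertible and `Q` is the orthogonal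
projection onto `ker A`, then `‖A v‖` is comparable to `‖(1 - Q) v‖`. By Pythagoras a lower frame
bound for `Ψ` thus amounts to `‖Q v‖ ≤ δ ‖v‖` with `δ < 1`. The vectors `v` fill the range of the
projection `G G†`, so this says `‖Q G G†‖ ≤ δ`. All constants depend only on `A`, `δ` and the frame
bounds, hence are uniform in `ω`; see `exists_matrixOpNorm_le_of_isFrameFor` and
`exists_isFrameFor_of_matrixOpNorm_le`.

Invertibility of `A * Aᴴ` comes from minimality of the length: a dependence between the rows of `A`
makes one `Ψ i` redundant, and by `eq_miSpan_of_total` the others still generate `M`. -/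

theorem ofReal_sum_norm_sq {n : ℕ} (v : Fin n → ℂ) :
    ((∑ i, ‖v i‖ ^ 2 : ℝ) : ℂ) = star v ⬝ᵥ v := by
  simp [dotProduct, Complex.conj_mul']

theorem exists_sum_norm_sq_mulVec_le {k n : ℕ} (A : Matrix (Fin k) (Fin n) ℂ) :
    ∃ C : ℝ, 0 < C ∧ ∀ v : Fin n → ℂ, ∑ i, ‖(A *ᵥ v) i‖ ^ 2 ≤ C * ∑ i, ‖v i‖ ^ 2 := by
  set T := (Matrix.toEuclideanLin A).toContinuousLinearMap
  -- The `+ 1` keeps the constant positive when `A = 0`.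
  refine ⟨‖T‖ ^ 2 + 1, by positivity, fun v => ?_⟩
  have h := T.le_opNorm (WithLp.toLp 2 v)
  have h1 : ‖T (WithLp.toLp 2 v)‖ ^ 2 = ∑ i, ‖(A *ᵥ v) i‖ ^ 2 := by
    rw [EuclideanSpace.norm_sq_eq]; rfl
  have h2 : ‖WithLp.toLp 2 v‖ ^ 2 = ∑ i, ‖v i‖ ^ 2 := by rw [EuclideanSpace.norm_sq_eq]
  rw [← h1, ← h2]
  have h3 := pow_le_pow_left₀ (norm_nonneg _) h 2
  rw [mul_pow] at h3
  nlinarith [sq_nonneg ‖WithLp.toLp 2 v‖]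

theorem matrixOpNorm_le_ofReal_iff {n : ℕ} (B : Matrix (Fin n) (Fin n) ℂ) {δ : ℝ} (hδ : 0 ≤ δ) :
    matrixOpNorm B ≤ ENNReal.ofReal δ ↔
      ∀ v : Fin n → ℂ, ∑ i, ‖(B *ᵥ v) i‖ ^ 2 ≤ δ ^ 2 * ∑ i, ‖v i‖ ^ 2 := by
  have key : ∀ v : Fin n → ℂ,
      ‖Matrix.toEuclideanCLM (n := Fin n) (𝕜 := ℂ) B (WithLp.toLp 2 v)‖ ≤
        δ * ‖WithLp.toLp 2 v‖ ↔ ∑ i, ‖(B *ᵥ v) i‖ ^ 2 ≤ δ ^ 2 * ∑ i, ‖v i‖ ^ 2 := fun v => by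
    rw [← pow_le_pow_iff_left₀ (norm_nonneg _) (by positivity) two_ne_zero, mul_pow,
      EuclideanSpace.norm_sq_eq, EuclideanSpace.norm_sq_eq]
    rfl
  rw [matrixOpNorm, ← ofReal_norm, ENNReal.ofReal_le_ofReal_iff hδ,
    ContinuousLinearMap.opNorm_le_iff hδ]
  exact ⟨fun h v => (key v).1 (h _), fun h v => (key v.ofLp).2 (h _)⟩

/-- Pythagoras for a Hermitian idempotent matrix. -/
theorem sum_norm_sq_eq_add_of_isHermitian {n : ℕ} {Q : Matrix (Fin n) (Fin n) ℂ}
    (hQ : Qᴴ = Q) (hQQ : Q * Q = Q) (v : Fin n → ℂ) :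
    ∑ i, ‖v i‖ ^ 2 = ∑ i, ‖(Q *ᵥ v) i‖ ^ 2 + ∑ i, ‖((1 - Q) *ᵥ v) i‖ ^ 2 := by
  have key : ∀ R : Matrix (Fin n) (Fin n) ℂ, Rᴴ = R → R * R = R →
      ((∑ i, ‖(R *ᵥ v) i‖ ^ 2 : ℝ) : ℂ) = star v ⬝ᵥ (R *ᵥ v) := fun R h1 h2 => by
    rw [ofReal_sum_norm_sq, star_mulVec, ← dotProduct_mulVec, h1, mulVec_mulVec, h2]
  have h1 : (1 - Q)ᴴ = 1 - Q := by rw [conjTranspose_sub, conjTranspose_one, hQ]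
  have h2 : (1 - Q) * (1 - Q) = 1 - Q := by
    rw [Matrix.mul_sub, Matrix.sub_mul, Matrix.sub_mul, hQQ]; simp
  apply Complex.ofReal_injective
  rw [Complex.ofReal_add, key Q hQ hQQ, key _ h1 h2, ofReal_sum_norm_sq, ← dotProduct_add,
    ← add_mulVec, add_sub_cancel, one_mulVec]

/-! ### The orthogonal projection onto the kernel of a matrix of full row rank -/

section KerProjection

variable {k n : ℕ} {A : Matrix (Fin k) (Fin n) ℂ}

theorem mul_ker_projection (hA : IsUnit (A * Aᴴ)) : A * (1 - Aᴴ * (A * Aᴴ)⁻¹ * A) = 0 := by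
  have h := Matrix.mul_nonsing_inv _ ((Matrix.isUnit_iff_isUnit_det _).1 hA)
  rw [Matrix.mul_sub, Matrix.mul_one, ← Matrix.mul_assoc, ← Matrix.mul_assoc, h, Matrix.one_mul,
    sub_self]

theorem isHermitian_ker_projection (A : Matrix (Fin k) (Fin n) ℂ) :
    (1 - Aᴴ * (A * Aᴴ)⁻¹ * A)ᴴ = 1 - Aᴴ * (A * Aᴴ)⁻¹ * A := by
  simp [Matrix.conjTranspose_nonsing_inv, Matrix.mul_assoc]

theorem ker_projection_mul_self (hA : IsUnit (A * Aᴴ)) :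
    (1 - Aᴴ * (A * Aᴴ)⁻¹ * A) * (1 - Aᴴ * (A * Aᴴ)⁻¹ * A) = 1 - Aᴴ * (A * Aᴴ)⁻¹ * A := by
  nth_rewrite 1 [Matrix.sub_mul]
  rw [Matrix.one_mul, Matrix.mul_assoc (Aᴴ * (A * Aᴴ)⁻¹), mul_ker_projection hA, Matrix.mul_zero,
    sub_zero]

end KerProjection

/-! ### Gramians of frames -/

section Gramian

variable {H : Type*} [NormedAddCommGroup H] [InnerProductSpace ℂ H] {k m : ℕ}

theorem gramian_mulVec (x : Fin m → H) (c : Fin m → ℂ) :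
    gramian x *ᵥ c = fun i => inner ℂ (∑ j, star (c j) • x j) (x i) := by
  ext i
  simp [mulVec, dotProduct, gramian, mul_comm]

/-- The analysis coefficients of any vector lie in the range of the projection `G G†`. -/
theorem gramian_mul_moorePenrose_mulVec_inner (x : Fin m → H) (f : H) :
    (gramian x * moorePenrose (gramian x)) *ᵥ (fun i => inner ℂ f (x i)) =
      fun i => inner ℂ f (x i) := by
  -- Projecting `f` onto the span of `x` does not change its coefficients, and those of a
  -- combination of the `x j` lie in the range of the Gramian.
  obtain ⟨c, hc⟩ : ∃ c : Fin m → ℂ, gramian x *ᵥ c = fun i => inner ℂ f (x i) := by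
    set K := Submodule.span ℂ (Set.range x)
    have : FiniteDimensional ℂ K := FiniteDimensional.span_of_finite ℂ (Set.finite_range x)
    obtain ⟨d, hd⟩ := (Submodule.mem_span_range_iff_exists_fun ℂ).1
      (K.starProjection_apply_mem f)
    refine ⟨fun j => star (d j), ?_⟩
    rw [gramian_mulVec]
    ext i
    simp only [star_star, hd]
    have h := K.sub_starProjection_mem_orthogonal f
    have h' := (Submodule.mem_orthogonal' _ _).1 h (x i) (Submodule.subset_span ⟨i, rfl⟩)
    rw [inner_sub_left, sub_eq_zero] at h'
    exact h'.symm
  rw [← hc, mulVec_mulVec, (moorePenrose_spec _).mul_mul_left]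

theorem exists_gramian_mul_moorePenrose_mulVec_eq {x : Fin m → H} {K : ClosedSubmodule ℂ H}
    (hx : ∀ i, x i ∈ K) (c : Fin m → ℂ) :
    ∃ f ∈ K, (gramian x * moorePenrose (gramian x)) *ᵥ c = fun i => inner ℂ f (x i) := by
  rw [← mulVec_mulVec, gramian_mulVec]
  exact ⟨_, K.toSubmodule.sum_mem fun j _ => K.toSubmodule.smul_mem _ (hx j), rfl⟩

/-- With `f` in the conjugate-linear slot the coefficients are linear in the family, so `A` acts
without conjugation. -/
theorem mulVec_inner (A : Matrix (Fin k) (Fin m) ℂ) (x : Fin m → H) (f : H) :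
    A *ᵥ (fun j => inner ℂ f (x j)) = fun i => inner ℂ f (∑ j, A i j • x j) := by
  ext i
  simp [mulVec, dotProduct]

/-- The contraction constant depends only on the matrix and the frame bounds. -/
theorem exists_matrixOpNorm_le_of_isFrameFor (A : Matrix (Fin k) (Fin m) ℂ)
    (hA : IsUnit (A * Aᴴ)) {β α' : ℝ} (hβ : 0 < β) (hα' : 0 < α') :
    ∃ δ : ℝ, 0 ≤ δ ∧ δ < 1 ∧ ∀ (x : Fin m → H) (K : ClosedSubmodule ℂ H) (α β' : ℝ),
      IsFrameFor x K α β → IsFrameFor (fun i => ∑ j, A i j • x j) K α' β' →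
        matrixOpNorm ((1 - Aᴴ * (A * Aᴴ)⁻¹ * A) * gramian x * moorePenrose (gramian x)) ≤
          ENNReal.ofReal δ := by
  obtain ⟨C, hC, hAC⟩ := exists_sum_norm_sq_mulVec_le A
  have hε : 0 < α' / (β * C) := by positivity
  refine ⟨√(1 - α' / (β * C)), Real.sqrt_nonneg _, ?_, fun x K α β' hx hy => ?_⟩
  · rw [Real.sqrt_lt' one_pos]; linarith
  rw [matrixOpNorm_le_ofReal_iff _ (Real.sqrt_nonneg _)]
  intro c
  set Q := 1 - Aᴴ * (A * Aᴴ)⁻¹ * A with hQ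
  have hP := moorePenrose_spec (gramian x)
  obtain ⟨f, hf, hfc⟩ := exists_gramian_mul_moorePenrose_mulVec_eq hx.1 c
  -- `G G†` is an orthogonal projection, so the bound for `v = G G† c` passes to arbitrary `c`.
  have hproj := sum_norm_sq_eq_add_of_isHermitian hP.isHermitian_left
    (by rw [← Matrix.mul_assoc, hP.mul_mul_left]) c
  rw [hfc] at hproj
  rw [Matrix.mul_assoc, ← mulVec_mulVec, hfc]
  set v : Fin m → ℂ := fun i => inner ℂ f (x i) with hv
  have h1 := sum_norm_sq_eq_add_of_isHermitian (isHermitian_ker_projection A)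
    (ker_projection_mul_self hA) v
  rw [← hQ] at h1
  have h2 : A *ᵥ v = A *ᵥ ((1 - Q) *ᵥ v) := by
    rw [mulVec_mulVec, Matrix.mul_sub, mul_ker_projection hA, Matrix.mul_one, sub_zero]
  have h3 := hAC ((1 - Q) *ᵥ v)
  rw [← h2, mulVec_inner] at h3
  have h4 := (hy.2 f hf).1
  have h5 := (hx.2 f hf).2
  simp only [norm_inner_symm _ f] at h4 h5
  have h7 : 0 ≤ ∑ i, ‖(Q *ᵥ v) i‖ ^ 2 := Finset.sum_nonneg fun _ _ => by positivity
  have h8 : 0 ≤ ∑ i, ‖((1 - gramian x * moorePenrose (gramian x)) *ᵥ c) i‖ ^ 2 :=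
    Finset.sum_nonneg fun _ _ => by positivity
  have h9 : 0 ≤ ∑ i, ‖v i‖ ^ 2 := Finset.sum_nonneg fun _ _ => by positivity
  have h10 : α' / (β * C) * ∑ i, ‖v i‖ ^ 2 ≤ ∑ i, ‖((1 - Q) *ᵥ v) i‖ ^ 2 := by
    rw [div_mul_eq_mul_div, div_le_iff₀ (by positivity)]
    have := h4.trans h3
    calc α' * ∑ i, ‖v i‖ ^ 2 ≤ α' * (β * ‖f‖ ^ 2) := by gcongr
      _ = β * (α' * ‖f‖ ^ 2) := by ring
      _ ≤ β * (C * ∑ i, ‖((1 - Q) *ᵥ v) i‖ ^ 2) := by gcongr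
      _ = _ := by ring
  -- If the radicand is negative, the square root is `0` by convention; `h10` then still forces `Q v
  -- = 0`.
  rcases le_or_gt 0 (1 - α' / (β * C)) with hs | hs
  · rw [Real.sq_sqrt hs]
    calc ∑ i, ‖(Q *ᵥ v) i‖ ^ 2 ≤ (1 - α' / (β * C)) * ∑ i, ‖v i‖ ^ 2 := by linarith
      _ ≤ _ := mul_le_mul_of_nonneg_left (by linarith) hs
  · have : (1 - α' / (β * C)) * ∑ i, ‖v i‖ ^ 2 ≤ 0 := mul_nonpos_of_nonpos_of_nonneg hs.le h9
    refine le_trans (b := 0) (by linarith) ?_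
    exact mul_nonneg (sq_nonneg _) (Finset.sum_nonneg fun _ _ => by positivity)

/-- The frame bounds depend only on the matrix, the contraction constant and the frame bounds. -/
theorem exists_isFrameFor_of_matrixOpNorm_le (A : Matrix (Fin k) (Fin m) ℂ)
    (hA : IsUnit (A * Aᴴ)) {α β δ : ℝ} (hα : 0 < α) (hδ : 0 ≤ δ) (hδ1 : δ < 1) :
    ∃ α' β' : ℝ, 0 < α' ∧ α' ≤ β' ∧ ∀ (x : Fin m → H) (K : ClosedSubmodule ℂ H),
      IsFrameFor x K α β →
      matrixOpNorm ((1 - Aᴴ * (A * Aᴴ)⁻¹ * A) * gramian x * moorePenrose (gramian x)) ≤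
        ENNReal.ofReal δ → IsFrameFor (fun i => ∑ j, A i j • x j) K α' β' := by
  obtain ⟨C, hC, hAC⟩ := exists_sum_norm_sq_mulVec_le A
  obtain ⟨C', hC', hAC'⟩ := exists_sum_norm_sq_mulVec_le (Aᴴ * (A * Aᴴ)⁻¹)
  have hδ2 : 0 < 1 - δ ^ 2 := by nlinarith
  -- `C'` bounds `Aᴴ * (A * Aᴴ)⁻¹`, which recovers `(1 - Q) v` from `A v`. The `max` ensures `α' ≤
  -- β'` even when `K` is zero and the bounds are unrelated.
  refine ⟨(1 - δ ^ 2) * α / C', max ((1 - δ ^ 2) * α / C') (C * β), by positivity,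
    le_max_left _ _, fun x K hx hn => ⟨fun i => ?_, fun f hf => ?_⟩⟩
  · exact K.toSubmodule.sum_mem fun j _ => K.toSubmodule.smul_mem _ (hx.1 j)
  rw [matrixOpNorm_le_ofReal_iff _ hδ] at hn
  have hn := hn fun i => inner ℂ f (x i)
  rw [Matrix.mul_assoc, ← mulVec_mulVec, gramian_mul_moorePenrose_mulVec_inner] at hn
  obtain ⟨h4, h5⟩ := hx.2 f hf
  simp only [norm_inner_symm _ f] at h4 h5 ⊢
  have hAv := mulVec_inner A x f
  set v : Fin m → ℂ := fun i => inner ℂ f (x i) with hv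
  have hsum : ∑ i, ‖inner ℂ f (∑ j, A i j • x j)‖ ^ 2 = ∑ i, ‖(A *ᵥ v) i‖ ^ 2 := by rw [hAv]
  rw [hsum]
  have h1 := sum_norm_sq_eq_add_of_isHermitian (isHermitian_ker_projection A)
    (ker_projection_mul_self hA) v
  rw [sub_sub_cancel] at h1
  have h2 := hAC' (A *ᵥ v)
  rw [mulVec_mulVec] at h2
  constructor
  · rw [div_mul_eq_mul_div, div_le_iff₀ hC']
    calc (1 - δ ^ 2) * α * ‖f‖ ^ 2 = (1 - δ ^ 2) * (α * ‖f‖ ^ 2) := by ring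
      _ ≤ (1 - δ ^ 2) * ∑ i, ‖v i‖ ^ 2 := by gcongr
      _ ≤ _ := by linarith
  · calc ∑ i, ‖(A *ᵥ v) i‖ ^ 2 ≤ C * ∑ i, ‖v i‖ ^ 2 := hAC v
      _ ≤ C * (β * ‖f‖ ^ 2) := by gcongr
      _ = C * β * ‖f‖ ^ 2 := by ring
      _ ≤ _ := by gcongr; exact le_max_right _ _

end Gramian

/-! ### Multiplicatively invariant spaces -/

section MI

variable {Ω : Type*} [MeasurableSpace Ω] {μ : Measure Ω}
  {H : Type*} [NormedAddCommGroup H] [InnerProductSpace ℂ H]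

theorem smul_mem_of_isRangeFunctionOf [CompleteSpace H] {J : Ω → ClosedSubmodule ℂ H}
    {M : Submodule ℂ (Lp H 2 μ)} (hJ : IsRangeFunctionOf J M) (g : Lp ℂ ∞ μ) {F : Lp H 2 μ}
    (hF : F ∈ M) : g • F ∈ M := by
  rw [hJ.mem_iff] at hF ⊢
  filter_upwards [hF, Lp.coeFn_lpSMul (r := 2) g F] with ω h1 h2
  rw [h2]
  exact (J ω).toSubmodule.smul_mem _ h1

/-- A vector orthogonal to all `g • Θ`, `g ∈ D`, is almost everywhere orthogonal to `Θ`. -/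
theorem ae_inner_eq_zero_of_isDeterminingSet {D : Set (Lp ℂ ∞ μ)} (hD : IsDeterminingSet D)
    {Θ F : Lp H 2 μ} (h : ∀ g ∈ D, inner ℂ F (g • Θ) = 0) :
    ∀ᵐ ω ∂μ, inner ℂ (F ω) (Θ ω) = 0 := by
  have hint : Integrable (fun ω => inner ℂ (F ω) (Θ ω)) μ := L2.integrable_inner F Θ
  have h0 : hint.toL1 _ = 0 := hD _ fun g hg => by
    rw [← h g hg, L2.inner_def]
    apply integral_congr_ae
    filter_upwards [hint.coeFn_toL1, Lp.coeFn_lpSMul (r := 2) g Θ] with ω h1 h2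
    rw [h1, h2, Pi.smul_apply', inner_smul_right, mul_comm]
  filter_upwards [hint.coeFn_toL1, Lp.coeFn_zero ℂ 1 μ] with ω h1 h2
  rw [← h1, h0, h2]; rfl

/-- A family in `M` generates `M` as soon as its values are total in the fibres. -/
theorem eq_miSpan_of_total [CompleteSpace H] {D : Set (Lp ℂ ∞ μ)} (hD : IsDeterminingSet D)
    {J : Ω → ClosedSubmodule ℂ H} {M : Submodule ℂ (Lp H 2 μ)} (hJ : IsRangeFunctionOf J M)
    (hM : IsClosed (M : Set (Lp H 2 μ))) {r : ℕ} {Θ : Fin r → Lp H 2 μ} (hΘ : ∀ i, Θ i ∈ M)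
    (htot : ∀ᵐ ω ∂μ, ∀ f ∈ J ω, (∀ i, inner ℂ f (Θ i ω) = 0) → f = 0) :
    M = miSpan D Θ := by
  have hle : miSpan D Θ ≤ M := by
    refine Submodule.topologicalClosure_minimal _ (Submodule.span_le.2 ?_) hM
    rintro _ ⟨g, -, i, rfl⟩
    exact smul_mem_of_isRangeFunctionOf hJ g (hΘ i)
  have : CompleteSpace (miSpan D Θ) :=
    (Submodule.isClosed_topologicalClosure _).completeSpace_coe
  refine le_antisymm (fun F hF => ?_) hle
  set p := (miSpan D Θ).starProjection F
  have hp : p ∈ miSpan D Θ := Submodule.starProjection_apply_mem _ _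
  suffices h : F - p = 0 by rw [sub_eq_zero.1 h]; exact hp
  have hmem := (hJ.mem_iff _).1 (M.sub_mem hF (hle hp))
  have horth := (Submodule.mem_orthogonal' _ _).1
    ((miSpan D Θ).sub_starProjection_mem_orthogonal F)
  have hae := ae_all_iff.2 fun i => ae_inner_eq_zero_of_isDeterminingSet hD (Θ := Θ i)
    (F := F - p) fun g hg => horth _ <|
      Submodule.le_topologicalClosure _ (Submodule.subset_span ⟨g, hg, i, rfl⟩)
  -- The residual `F - p` takes values in the fibres and is pointwise orthogonal to every `Θ i`, so
  -- totality kills it.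
  rw [Lp.eq_zero_iff_ae_eq_zero]
  filter_upwards [hmem, hae, htot] with ω h1 h2 h3 using h3 _ h1 h2

theorem coeFn_sum_smul {k m : ℕ} (A : Matrix (Fin k) (Fin m) ℂ) (Φ : Fin m → Lp H 2 μ) :
    ∀ᵐ ω ∂μ, ∀ i, (∑ j, A i j • Φ j : Lp H 2 μ) ω = ∑ j, A i j • Φ j ω := by
  refine ae_all_iff.2 fun i => ?_
  filter_upwards [Lp.coeFn_finsetSum Finset.univ fun j => A i j • Φ j,
    ae_all_iff.2 fun j => Lp.coeFn_smul (A i j) (Φ j)] with ω h1 h2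
  rw [h1]
  simp [h2]

open scoped ComplexOrder in
/-- A uniform frame consisting of `ℓ(M)` combinations of a family comes from a matrix of full
row rank: otherwise one of its members could be dropped, and `M` would have fewer generators. -/
theorem isUnit_mul_conjTranspose_of_isUniformFrame [CompleteSpace H] {D : Set (Lp ℂ ∞ μ)}
    (hD : IsDeterminingSet D) {J : Ω → ClosedSubmodule ℂ H} {M : Submodule ℂ (Lp H 2 μ)}
    (hJ : IsRangeFunctionOf J M) (hM : IsClosed (M : Set (Lp H 2 μ))) {m ℓ : ℕ}
    {Φ : Fin m → Lp H 2 μ} (hℓ : miLength D M = ℓ) {A : Matrix (Fin ℓ) (Fin m) ℂ}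
    (hΨ : IsUniformFrame (fun i : Fin ℓ => ∑ j, A i j • Φ j) J) : IsUnit (A * Aᴴ) := by
  by_contra hA
  rw [Matrix.isUnit_iff_isUnit_det, isUnit_iff_ne_zero, not_not] at hA
  obtain ⟨w, hw0, hw⟩ := Matrix.exists_vecMul_eq_zero_iff.2 hA
  have hwA : w ᵥ* A = 0 := (vecMul_self_mul_conjTranspose_eq_zero A w).1 hw
  obtain ⟨i₀, hi₀⟩ := Function.ne_iff.1 hw0
  cases ℓ with
  | zero => exact i₀.elim0
  | succ r =>
    obtain ⟨α, β, hα, -, hfr⟩ := hΨ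
    have hrel : ∑ i, w i • ∑ j, A i j • Φ j = 0 := by
      simp_rw [Finset.smul_sum, smul_smul]
      rw [Finset.sum_comm]
      refine Finset.sum_eq_zero fun j _ => ?_
      rw [← Finset.sum_smul]
      have := congrFun hwA j
      rw [vecMul, dotProduct] at this
      rw [this, Pi.zero_apply, zero_smul]
    set Ψ : Fin (r + 1) → Lp H 2 μ := fun i => ∑ j, A i j • Φ j with hΨdef
    have hΨM : ∀ i, Ψ i ∈ M := fun i => (hJ.mem_iff _).2 <| hfr.mono fun ω h => h.1 i
    have hmem : r ∈ {n : ℕ | ∃ Θ : Fin n → Lp H 2 μ, (∀ i, Θ i ∈ M) ∧ M = miSpan D Θ} := by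
      refine ⟨fun k => Ψ (i₀.succAbove k), fun k => hΨM _,
        eq_miSpan_of_total hD hJ hM (fun k => hΨM _) ?_⟩
      -- Viewing `w` as a one-row matrix gives the relation pointwise. As `w i₀ ≠ 0`, a vector
      -- orthogonal to the other members is orthogonal to `Ψ i₀` too, and the lower frame bound
      -- makes it zero.
      have hrel' := coeFn_sum_smul (fun _ : Fin 1 => w) Ψ
      filter_upwards [hfr, hrel', Lp.coeFn_zero H 2 μ] with ω h1 h2 h3 f hf hf0
      have h2 := h2 0
      rw [show (∑ i, w i • Ψ i) = 0 from hrel, h3, Fin.sum_univ_succAbove _ i₀] at h2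
      have h4 := congrArg (inner ℂ f) h2
      simp only [Pi.zero_apply, inner_zero_right, inner_add_right, inner_sum, inner_smul_right,
        hf0, mul_zero, Finset.sum_const_zero, add_zero, zero_eq_mul] at h4
      have h5 : ∀ i, inner ℂ f (Ψ i ω) = 0 :=
        Fin.forall_iff_succAbove i₀ |>.2 ⟨h4.resolve_left hi₀, hf0⟩
      have h6 := (h1.2 f hf).1
      simp only [norm_inner_symm _ f, h5, norm_zero, ne_eq, OfNat.ofNat_ne_zero,
        not_false_eq_true, zero_pow, Finset.sum_const_zero] at h6
      by_contra hf'
      have : 0 < α * ‖f‖ ^ 2 := by positivity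
      linarith
    have := Nat.sInf_le hmem
    rw [miLength] at hℓ
    omega

end MI

theorem theorem3p7 {Ω : Type*} [MeasurableSpace Ω] (μ : Measure Ω) [SigmaFinite μ]
    {H : Type*} [NormedAddCommGroup H] [InnerProductSpace ℂ H] [CompleteSpace H]
    [TopologicalSpace.SeparableSpace H]
    (D : Set (Lp ℂ ∞ μ)) (hD : IsDeterminingSet D)
    {m ℓ : ℕ} (Φ : Fin m → Lp H 2 μ) (J : Ω → ClosedSubmodule ℂ H)
    (hJ : IsRangeFunctionOf J (miSpan D Φ)) (hΦ : IsUniformFrame Φ J)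
    (hℓ : miLength D (miSpan D Φ) = ℓ)
    (A : Matrix (Fin ℓ) (Fin m) ℂ) :
    IsUniformFrame (fun i : Fin ℓ => ∑ j, A i j • Φ j) J ↔
      IsUnit (A * Aᴴ) ∧
        essSup (fun ω => matrixOpNorm ((1 - Aᴴ * (A * Aᴴ)⁻¹ * A) *
          gramian (fun j => Φ j ω) * moorePenrose (gramian fun j => Φ j ω))) μ < 1 := by

  have hM : IsClosed (miSpan D Φ : Set (Lp H 2 μ)) := Submodule.isClosed_topologicalClosure _
  have hsum := coeFn_sum_smul A Φ
  constructor
  · intro hΨ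
    have hA := isUnit_mul_conjTranspose_of_isUniformFrame hD hJ hM hℓ hΨ
    refine ⟨hA, ?_⟩
    obtain ⟨α, β, hα, hαβ, hx⟩ := hΦ
    obtain ⟨α', β', hα', -, hy⟩ := hΨ
    obtain ⟨δ, -, hδ1, h⟩ := exists_matrixOpNorm_le_of_isFrameFor (H := H) A hA
      (hα.trans_le hαβ) hα'
    refine lt_of_le_of_lt (essSup_le_of_ae_le (ENNReal.ofReal δ) ?_)
      (ENNReal.ofReal_lt_one.2 hδ1)
    filter_upwards [hx, hy, hsum] with ω h1 h2 h3
    simp only [h3] at h2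
    exact h _ _ _ _ h1 h2
  · rintro ⟨hA, hess⟩
    obtain ⟨α, β, hα, hαβ, hx⟩ := hΦ
    set s := essSup (fun ω => matrixOpNorm ((1 - Aᴴ * (A * Aᴴ)⁻¹ * A) *
          gramian (fun j => Φ j ω) * moorePenrose (gramian fun j => Φ j ω))) μ with hs
    have hs_top : s ≠ ∞ := (hess.trans ENNReal.one_lt_top).ne
    have hs1 : s.toReal < 1 := by
      rwa [← ENNReal.toReal_one, ENNReal.toReal_lt_toReal hs_top ENNReal.one_ne_top]
    obtain ⟨α', β', hα', hαβ', h⟩ := exists_isFrameFor_of_matrixOpNorm_le (H := H) A hA hα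
      ENNReal.toReal_nonneg hs1
    refine ⟨α', β', hα', hαβ', ?_⟩
    filter_upwards [hx, hsum, ENNReal.ae_le_essSup (μ := μ) fun ω =>
      matrixOpNorm ((1 - Aᴴ * (A * Aᴴ)⁻¹ * A) *
          gramian (fun j => Φ j ω) * moorePenrose (gramian fun j => Φ j ω))] with ω h1 h2 h3
    simp only [h2]
    exact h _ _ h1 (by rwa [ENNReal.ofReal_toReal hs_top])
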